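/- **Theorem 3.5.** Let $\mu$ be a $\sigma$-finite Borel measure on $\mathbb R$ without atoms and let $U\subset\mathbb R$ be a Borel set with $\mu(\mathbb R\setminus U)=0$. Let $H$ be a reproducing kernel subspace of $L^2(\mathbb R,\mu)$, that is, a complex linear space of Borel functions $f:U\to\mathbb C$ with $\int|f|^2\,d\mu<\infty$ which is closed in the $L^2(\mathbb R,\mu)$ norm and on which every evaluation $f\mapsto f(k)$, $k\in U$, is bounded in the $L^2(\mathbb R,\mu)$ norm. For $w\in U$ let $K_w\in H$ be the reproducing kernel at $w$, so that $f(w)=\langle f,K_w\rangle=\int f\,\overline{K_w}\,d\mu$ for all $f\in H$. Suppose that $H$ separates zeros (for every $q\in U$ there is $f\in H$ with $f(q)\neq0$) and has the weak division property: if $k\in U$, $f\in H$ and $f(k)=0$, then there is $g\in H$ with $f(x)=(x-k)g(x)$ for all $x\in U$. Denote by $\partial U$ the boundary of $U$ in $\mathbb R$. Then for every $p\in U$ the following hold. 1. The accumulation points of the set $\{x\in U: K_p(x)=0\}$ are contained in $\partial U\cup\{\infty\}$. 2. There is an open neighbourhood $V_p\subset\mathbb C$ of $p$ such that $K_p$ has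 no zeros in $U\cap V_p$ and for every $f\in H$ the function $f/K_p$ on $U\cap V_p$ extends to an analytic function on $V_p$. 3. There is a set $\mathcal N_p\subset\mathbb R\setminus\partial U$ without accumulation points in $\mathbb R\setminus\partial U$ such that for every $f\in H$ the function $f/K_p$, defined at the points of $U\setminus\partial U$ where $K_p\ne0$, extends to a meromorphic function on $\mathbb C\setminus\partial U$ all of whose poles lie in $\mathcal N_p$; this extension can be chosen to coincide on $V_p\setminus\partial U$ with an analytic extension as in (2). -/

import Mathlib

open MeasureTheory Filter Topology

noncomputable section

/-- The measure `μ` on `ℝ`, carried by the Borel set `U`, regarded as a measure on `U`. -/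
def measureOn (μ : Measure ℝ) (U : Set ℝ) : Measure U :=
  μ.comap ((↑) : U → ℝ)

/-- A reproducing kernel subspace of `L²(ℝ, μ)`: a linear set of genuine Borel functions on `U`
(not of classes modulo null sets), square integrable, closed in the `L²` norm, and such that every
point evaluation is bounded in the `L²` norm. -/
structure IsReproducingKernelSubspace (μ : Measure ℝ) (U : Set ℝ) (H : Submodule ℂ (U → ℂ)) :
    Prop where
  measurable : ∀ f ∈ H, Measurable f
  memLp : ∀ f ∈ H, MemLp f 2 (measureOn μ U)
  closed : IsClosed {F : Lp ℂ 2 (measureOn μ U) | ∃ f ∈ H, (F : U → ℂ) =ᵐ[measureOn μ U] f}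
  eval_bounded : ∀ k : U, ∃ C : ℝ, ∀ f ∈ H,
    ‖f k‖ ≤ C * (eLpNorm f 2 (measureOn μ U)).toReal

/-- `K` is a reproducing element of `H` at `w`: `K ∈ H` and `f(w) = ⟨f, K⟩` for all `f ∈ H`. -/
def IsKernelAt (μ : Measure ℝ) (U : Set ℝ) (H : Submodule ℂ (U → ℂ)) (w : U) (K : U → ℂ) : Prop :=
  K ∈ H ∧ ∀ f ∈ H, f w = ∫ x, f x * (starRingEnd ℂ) (K x) ∂(measureOn μ U)

/-- In a reproducing kernel subspace there is exactly one reproducing element at each point. -/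
theorem IsReproducingKernelSubspace.existsUnique_kernel {μ : Measure ℝ} {U : Set ℝ}
    {H : Submodule ℂ (U → ℂ)} (hH : IsReproducingKernelSubspace μ U H) (w : U) :
    ∃! K : U → ℂ, IsKernelAt μ U H w K := by
  set ν := measureOn μ U with hν
  -- the image of `H` in `L²`
  let S : Submodule ℂ (Lp ℂ 2 ν) :=
    { carrier := {F | ∃ f ∈ H, (F : U → ℂ) =ᵐ[ν] f}
      add_mem' := by
        rintro F G ⟨f, hf, hFf⟩ ⟨g, hg, hGg⟩
        exact ⟨f + g, H.add_mem hf hg, (Lp.coeFn_add F G).trans (hFf.add hGg)⟩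
      zero_mem' := ⟨0, H.zero_mem, Lp.coeFn_zero ℂ 2 ν⟩
      smul_mem' := by
        rintro c F ⟨f, hf, hFf⟩
        exact ⟨c • f, H.smul_mem c hf, (Lp.coeFn_smul c F).trans (hFf.const_smul c)⟩ }
  have hS : IsClosed (S : Set (Lp ℂ 2 ν)) := hH.closed
  have : CompleteSpace S := hS.completeSpace_coe
  obtain ⟨C, hC⟩ := hH.eval_bounded w
  have huniq : ∀ f ∈ H, ∀ g ∈ H, f =ᵐ[ν] g → f w = g w := by
    intro f hf g hg hfg
    have h := hC (f - g) (H.sub_mem hf hg)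
    have h0 : eLpNorm (f - g) 2 ν = 0 := by
      rw [eLpNorm_congr_ae (g := 0) (by filter_upwards [hfg] with x hx; simp [hx])]
      exact eLpNorm_zero
    rw [h0] at h
    have : f w - g w = 0 := by simpa using h
    exact sub_eq_zero.mp this
  choose r hrH hr using fun F : S => F.2
  -- evaluation at `w`, as a bounded functional on the image
  let ev : S →ₗ[ℂ] ℂ :=
    { toFun := fun F => r F w
      map_add' := by
        intro F G
        refine huniq (r (F + G)) (hrH _) (r F + r G) (H.add_mem (hrH F) (hrH G)) ?_
        exact (hr (F + G)).symm.trans ((Lp.coeFn_add _ _).trans ((hr F).add (hr G)))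
      map_smul' := by
        intro c F
        refine huniq (r (c • F)) (hrH _) (c • r F) (H.smul_mem c (hrH F)) ?_
        exact (hr (c • F)).symm.trans ((Lp.coeFn_smul _ _).trans ((hr F).const_smul c)) }
  let evL : S →L[ℂ] ℂ := ev.mkContinuous C (by
    intro F
    have h := hC (r F) (hrH F)
    rw [eLpNorm_congr_ae (hr F).symm] at h
    exact h)
  let k : S := (InnerProductSpace.toDual ℂ S).symm evL
  have hk : ∀ F : S, inner ℂ k F = r F w := by
    intro F
    exact InnerProductSpace.toDual_symm_apply
  have hex : IsKernelAt μ U H w (r k) := by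
    refine ⟨hrH k, fun f hf => ?_⟩
    let F : S := ⟨(hH.memLp f hf).toLp f, f, hf, (hH.memLp f hf).coeFn_toLp⟩
    have hF : ((F : Lp ℂ 2 ν) : U → ℂ) =ᵐ[ν] f := (hH.memLp f hf).coeFn_toLp
    have h1 : r F w = f w := huniq _ (hrH F) _ hf ((hr F).symm.trans hF)
    rw [← h1, ← hk F, Submodule.coe_inner, L2.inner_def]
    refine integral_congr_ae ?_
    filter_upwards [hF, hr k] with x hx hkx
    rw [hx, hkx]
    simp [RCLike.inner_apply]
  refine ⟨r k, hex, fun K' hK' => ?_⟩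
  -- uniqueness: the difference is orthogonal to itself
  have hd : K' - r k ∈ H := H.sub_mem hK'.1 hex.1
  have hmem := hH.memLp _ hd
  have hint : ∀ f ∈ H, ∀ g ∈ H, Integrable (fun x => f x * (starRingEnd ℂ) (g x)) ν := by
    intro f hf g hg
    exact (hH.memLp f hf).integrable_mul (q := 2) (p := 2) (hH.memLp g hg).star
  have h0 : ∫ x, (K' - r k) x * (starRingEnd ℂ) ((K' - r k) x) ∂ν = 0 := by
    have h1 := hK'.2 _ hd
    have h2 := hex.2 _ hd
    have h3 : ∀ x, (K' - r k) x * (starRingEnd ℂ) ((K' - r k) x)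
        = (K' - r k) x * (starRingEnd ℂ) (K' x) - (K' - r k) x * (starRingEnd ℂ) (r k x) := by
      intro x
      simp only [Pi.sub_apply, map_sub]
      ring
    simp_rw [h3]
    rw [integral_sub (hint _ hd _ hK'.1) (hint _ hd _ hex.1), ← h1, ← h2, sub_self]
  have hae : (K' - r k) =ᵐ[ν] 0 := by
    have h4 : ∫ x, ‖(K' - r k) x‖ ^ 2 ∂ν = 0 := by
      have : ∫ x, (((‖(K' - r k) x‖ ^ 2 : ℝ)) : ℂ) ∂ν = 0 := by
        rw [← h0]
        congr 1
        funext x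
        rw [RCLike.mul_conj]
        norm_cast
      rw [integral_complex_ofReal] at this
      exact_mod_cast this
    rw [integral_eq_zero_iff_of_nonneg (fun x => by positivity)
      ((memLp_two_iff_integrable_sq_norm hmem.1).1 hmem)] at h4
    filter_upwards [h4] with x hx
    simpa using hx
  have hae' : K' =ᵐ[ν] r k := by
    filter_upwards [hae] with x hx
    exact sub_eq_zero.mp hx
  funext y
  obtain ⟨C', hC'⟩ := hH.eval_bounded y
  have h := hC' _ hd
  rw [eLpNorm_congr_ae hae, eLpNorm_zero] at h
  have : K' y - r k y = 0 := by simpa using h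
  exact sub_eq_zero.mp this

open Classical in
/-- The reproducing kernel: `reproducingKernel μ U H w` is the function `K_w = K(·, w)` on `U`. (The
value `0` of the second branch does not occur for reproducing kernel subspaces.) -/
def reproducingKernel (μ : Measure ℝ) (U : Set ℝ) (H : Submodule ℂ (U → ℂ)) (w : U) : U → ℂ :=
  if h : ∃ K : U → ℂ, IsKernelAt μ U H w K then h.choose else 0

theorem IsReproducingKernelSubspace.isKernelAt_reproducingKernel {μ : Measure ℝ} {U : Set ℝ}
    {H : Submodule ℂ (U → ℂ)} (hH : IsReproducingKernelSubspace μ U H) (w : U) :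
    IsKernelAt μ U H w (reproducingKernel μ U H w) := by
  have h := (hH.existsUnique_kernel w).exists
  rw [reproducingKernel, dif_pos h]
  exact h.choose_spec

/-- `H` separates zeros: at every point of `U` some element of `H` does not vanish. -/
def SeparatesZeros (U : Set ℝ) (H : Submodule ℂ (U → ℂ)) : Prop :=
  ∀ p : U, ∃ f ∈ H, f p ≠ 0

/-- The weak division property: if `f ∈ H` and `f(k) = 0` then `f / (x - k) ∈ H`, that is,
`f(x) = (x - k) g(x)` on all of `U` for some `g ∈ H`. (For a measure without atoms such a `g` is
unique, as elements of `H` that agree almost everywhere are equal.) -/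
def WeakDivision (U : Set ℝ) (H : Submodule ℂ (U → ℂ)) : Prop :=
  ∀ k : U, ∀ f ∈ H, f k = 0 → ∃ g ∈ H, ∀ x : U, f x = (((x : ℝ) : ℂ) - ((k : ℝ) : ℂ)) * g x

end

/-! Let `A` be multiplication by the coordinate in `H`, on its maximal domain. Evaluations are
continuous, so `A` is closed; the coordinate is real, so `A` is symmetric; `μ` has no atoms, so `A`
has no eigenvalues. If `e` spans a complement of `ran (A - z)`, write `f = c(z) e + (A - z) h`. At a
point `z = x` of `U`, evaluation gives `f(x) = c(x) e(x)`. So the coefficient of `f` along `K_p`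
extends `f / K_p`, and one function serves both for the analytic and for the meromorphic claim.

It remains to find where `K_p` is transversal. The condition is open and the coefficient is analytic
there (`eventually_and_analyticAt`). By weak division, it holds at every point of `U` where `K_p` is
nonzero, in particular at `p`, where `K_p(p) = ‖K_p‖²`. Since `K_p` is orthogonal to `ran (A - p)`,
a self-adjoint compression gives it at all nonreal points (`of_im_ne_zero`).

At a real point `a` off the boundary some vector `e` is transversal: by weak division if `a ∈ U`,
and otherwise because `A - z` is bounded below for `z` near `a` (`exists_of_bounded_below`). The
coefficient of `K_p` along `e` is analytic near `a` and nonzero off the real line, so its zeros are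
isolated; dividing by it makes the coefficients along `K_p` meromorphic at `a`. -/

section Transversal

/-! ### Complements of the range of `A - z` for a closed operator `A`. -/

variable {E : Type*} [NormedAddCommGroup E] [InnerProductSpace ℂ E]

/-- If `Γ` is the graph of an operator `A`, the vector `e` spans an algebraic complement of the
range of `A - z`. -/
structure IsTransversal (Γ : Submodule ℂ (E × E)) (e : E) (z : ℂ) : Prop where
  exists_decomp : ∀ f : E, ∃ c : ℂ, ∃ h : E, (h, f - c • e + z • h) ∈ Γ
  notMem_range : ∀ h : E, (h, e + z • h) ∉ Γ

open Classical in
/-- The coefficient of `e` in the decomposition of `f` along `e` and the range of `A - z`. -/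
noncomputable def transversalCoeff (Γ : Submodule ℂ (E × E)) (e : E) (f : E) (z : ℂ) : ℂ :=
  if h : ∃ c : ℂ, ∃ h : E, (h, f - c • e + z • h) ∈ Γ then h.choose else 0

namespace IsTransversal

variable {Γ : Submodule ℂ (E × E)} {e : E} {z : ℂ}

theorem coeff_unique (he : IsTransversal Γ e z) {f : E} {c c' : ℂ} {h h' : E}
    (hc : (h, f - c • e + z • h) ∈ Γ) (hc' : (h', f - c' • e + z • h') ∈ Γ) : c = c' := by
  by_contra hne
  have h0 : c' - c ≠ 0 := fun h => hne (sub_eq_zero.mp h).symm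
  have h1 := Γ.smul_mem (c' - c)⁻¹ (Γ.sub_mem hc hc')
  refine he.notMem_range ((c' - c)⁻¹ • (h - h')) ?_
  convert h1 using 1
  refine Prod.ext rfl ?_
  have h2 : f - c • e + z • h - (f - c' • e + z • h') = (c' - c) • e + z • (h - h') := by module
  simp only [Prod.snd_sub, Prod.smul_snd, h2, smul_add, inv_smul_smul₀ h0]
  rw [smul_comm]

theorem coeff_spec (he : IsTransversal Γ e z) (f : E) :
    ∃ h : E, (h, f - transversalCoeff Γ e f z • e + z • h) ∈ Γ := by
  have h := he.exists_decomp f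
  rw [transversalCoeff, dif_pos h]
  exact h.choose_spec

theorem coeff_eq (he : IsTransversal Γ e z) {f : E} {c : ℂ} {h : E}
    (hc : (h, f - c • e + z • h) ∈ Γ) : transversalCoeff Γ e f z = c := by
  obtain ⟨h', hh'⟩ := he.coeff_spec f
  exact he.coeff_unique hh' hc

/-- Modulo `ran (A - z)` the vector `k` is a nonzero multiple of `e`. -/
theorem of_coeff_ne_zero (he : IsTransversal Γ e z) {k : E}
    (hk : transversalCoeff Γ e k z ≠ 0) : IsTransversal Γ k z := by
  obtain ⟨u, hu⟩ := he.coeff_spec k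
  set κ := transversalCoeff Γ e k z
  refine ⟨fun f => ?_, fun h hh => hk ?_⟩
  · obtain ⟨c, h, hh⟩ := he.exists_decomp f
    refine ⟨c / κ, h - (c / κ) • u, ?_⟩
    convert Γ.sub_mem hh (Γ.smul_mem (c / κ) hu) using 1
    refine Prod.ext rfl ?_
    have : c • e = (c / κ) • κ • e := by rw [smul_smul, div_mul_cancel₀ _ hk]
    simp only [Prod.snd_sub, Prod.smul_snd, this]
    module
  · refine he.coeff_unique hu (c' := 0) (h' := h) ?_
    simpa using hh

/-- Change of basis in the one-dimensional quotient by `ran (A - z)`; it turns coefficients along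
`k` into quotients of coefficients along `e`. -/
theorem coeff_mul_coeff (he : IsTransversal Γ e z) {k : E} (hk : IsTransversal Γ k z) (f : E) :
    transversalCoeff Γ e f z = transversalCoeff Γ k f z * transversalCoeff Γ e k z := by
  obtain ⟨u, hu⟩ := he.coeff_spec k
  obtain ⟨h, hh⟩ := hk.coeff_spec f
  refine he.coeff_eq (h := h + transversalCoeff Γ k f z • u) ?_
  convert Γ.add_mem hh (Γ.smul_mem (transversalCoeff Γ k f z) hu) using 1
  refine Prod.ext rfl ?_
  simp only [Prod.snd_add, Prod.smul_snd]
  module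

theorem coeff_ne_zero (he : IsTransversal Γ e z) {k : E} (hk : IsTransversal Γ k z) :
    transversalCoeff Γ e k z ≠ 0 := by
  intro h0
  obtain ⟨u, hu⟩ := he.coeff_spec k
  rw [h0, zero_smul, sub_zero] at hu
  exact hk.notMem_range u hu

/-- The decomposition along `e` and the range of `A - z` is bounded, by the closed graph theorem. -/
theorem exists_continuous_decomp [CompleteSpace E] (hΓ : IsClosed (Γ : Set (E × E)))
    (hinj : ∀ h : E, (h, z • h) ∈ Γ → h = 0) (he : IsTransversal Γ e z) :
    ∃ (ℓ : E →L[ℂ] ℂ) (T : E →L[ℂ] E), ∀ f, (T f, f - ℓ f • e + z • T f) ∈ Γ := by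
  have huniq : ∀ {f : E} {c c' : ℂ} {h h' : E}, (h, f - c • e + z • h) ∈ Γ →
      (h', f - c' • e + z • h') ∈ Γ → (c, h) = (c', h') := by
    intro f c c' h h' hc hc'
    obtain rfl := he.coeff_unique hc hc'
    refine Prod.ext rfl (sub_eq_zero.mp (hinj _ ?_))
    convert Γ.sub_mem hc hc' using 1
    refine Prod.ext rfl ?_
    simp only [Prod.snd_sub]
    module
  choose c h hch using he.exists_decomp
  let L : E →ₗ[ℂ] ℂ × E :=
    { toFun := fun f => (c f, h f)
      map_add' := by
        intro f g
        refine huniq (hch (f + g)) (c' := c f + c g) (h' := h f + h g) ?_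
        convert Γ.add_mem (hch f) (hch g) using 1
        refine Prod.ext rfl ?_
        simp only [Prod.snd_add]
        module
      map_smul' := by
        intro a f
        refine huniq (hch (a • f)) (c' := a • c f) (h' := a • h f) ?_
        convert Γ.smul_mem a (hch f) using 1
        refine Prod.ext rfl ?_
        simp only [Prod.smul_snd, smul_eq_mul]
        module }
  have hgraph : (L.graph : Set (E × (ℂ × E))) =
      (fun q : E × (ℂ × E) => (q.2.2, q.1 - q.2.1 • e + z • q.2.2)) ⁻¹' (Γ : Set (E × E)) := by
    ext ⟨f, a, u⟩
    simp only [SetLike.mem_coe, LinearMap.mem_graph_iff, Set.mem_preimage]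
    constructor
    · intro hau
      have h1 : a = c f := congrArg Prod.fst hau
      have h2 : u = h f := congrArg Prod.snd hau
      rw [h1, h2]
      exact hch f
    · intro hau
      exact huniq hau (hch f)
  have hL : Continuous L := by
    refine L.continuous_of_isClosed_graph ?_
    rw [hgraph]
    exact hΓ.preimage (by fun_prop)
  let L' : E →L[ℂ] ℂ × E := ⟨L, hL⟩
  exact ⟨(ContinuousLinearMap.fst ℂ ℂ E).comp L', (ContinuousLinearMap.snd ℂ ℂ E).comp L', hch⟩

/-- The resolvent of `T` produces the decomposition at `w` from the decomposition at `z`. -/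
theorem mem_of_resolvent {ℓ : E →L[ℂ] ℂ} {T : E →L[ℂ] E}
    (hT : ∀ f, (T f, f - ℓ f • e + z • T f) ∈ Γ) {w : ℂ}
    (hw : IsUnit (1 - (w - z) • T)) (f : E) :
    (T (Ring.inverse (1 - (w - z) • T) f),
      f - ℓ (Ring.inverse (1 - (w - z) • T) f) • e +
        w • T (Ring.inverse (1 - (w - z) • T) f)) ∈ Γ := by
  set u := Ring.inverse (1 - (w - z) • T) f with hu
  have h1 : u - (w - z) • T u = f := by
    have := congrArg (fun S : E →L[ℂ] E => S f) (Ring.mul_inverse_cancel _ hw)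
    simpa using this
  -- Since `(A - z) T u = u - ℓ(u) e`, one has `(A - w) T u = (1 - (w - z) T) u - ℓ(u) e = f - ℓ(u)
  -- e`.
  convert hT u using 2
  nth_rewrite 1 [← h1]
  module

/-- The resolvent of `T` supplies the decomposition at `w`. If `e = (A - w) h`, then `(A - z) h = e
+ (w - z) h`; applying `T`, which kills `e`, gives `(1 - (w - z) T) h = 0`, hence `h = 0` and `e =
0`, which is impossible. -/
theorem of_isUnit (he : IsTransversal Γ e z) (hinj : ∀ h : E, (h, z • h) ∈ Γ → h = 0)
    {ℓ : E →L[ℂ] ℂ} {T : E →L[ℂ] E}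
    (hT : ∀ f, (T f, f - ℓ f • e + z • T f) ∈ Γ) {w : ℂ}
    (hw : IsUnit (1 - (w - z) • T)) : IsTransversal Γ e w := by
  refine ⟨fun f => ⟨_, _, mem_of_resolvent hT hw f⟩, fun h hh => ?_⟩
  have hval : ∀ {g u : E} {a : ℂ}, (u, g - a • e + z • u) ∈ Γ → T g = u := by
    intro g u a hu
    have ha : ℓ g = a := he.coeff_unique (hT g) hu
    refine sub_eq_zero.mp (hinj _ ?_)
    convert Γ.sub_mem (hT g) hu using 1
    refine Prod.ext rfl ?_
    simp only [Prod.snd_sub, ha]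
    module
  have hTe : T e = 0 := by
    refine hval (a := 1) ?_
    simp [Γ.zero_mem, ← Prod.zero_eq_mk]
  have h1 : T (e + (w - z) • h) = h := by
    refine hval (a := 0) ?_
    convert hh using 2
    module
  have h2 : (1 - (w - z) • T) h = 0 := by
    have : (w - z) • T h = h := by simpa [hTe] using h1
    simp [this]
  have h3 : h = 0 := by
    have := congrArg (fun S : E →L[ℂ] E => S h) (Ring.inverse_mul_cancel _ hw)
    simp only [mul_apply_eq_comp, h2, map_zero] at this
    simpa using this.symm
  subst h3
  refine he.notMem_range 0 ?_
  simpa using hh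

/-- Near `z` the operator `1 - (w - z) T` is invertible, and the coefficient of `f` is `ℓ ((1 - (w -
z) T)⁻¹ f)`. -/
theorem eventually_and_analyticAt [CompleteSpace E] (hΓ : IsClosed (Γ : Set (E × E)))
    (hinj : ∀ h : E, (h, z • h) ∈ Γ → h = 0) (he : IsTransversal Γ e z) :
    (∀ᶠ w in 𝓝 z, IsTransversal Γ e w) ∧ ∀ f, AnalyticAt ℂ (transversalCoeff Γ e f) z := by
  obtain ⟨ℓ, T, hT⟩ := he.exists_continuous_decomp hΓ hinj
  have hunit : ∀ᶠ w in 𝓝 z, IsUnit (1 - (w - z) • T) := by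
    have hcont : ContinuousAt (fun w : ℂ => 1 - (w - z) • T) z := by fun_prop
    refine hcont.eventually (Units.isOpen.mem_nhds ?_)
    simp
  have htr : ∀ᶠ w in 𝓝 z, IsTransversal Γ e w :=
    hunit.mono fun w hw => he.of_isUnit hinj hT hw
  refine ⟨htr, fun f => ?_⟩
  have hinv : AnalyticAt ℂ (fun w : ℂ => Ring.inverse (1 - (w - z) • T)) z := by
    have h1 : AnalyticAt ℂ (fun w : ℂ => 1 - (w - z) • T) z :=
      analyticAt_const.sub ((analyticAt_id.sub analyticAt_const).smul analyticAt_const)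
    refine AnalyticAt.fun_comp (g := Ring.inverse) ?_ h1
    simpa using analyticAt_inverse (𝕜 := ℂ) (1 : (E →L[ℂ] E)ˣ)
  let ev : (E →L[ℂ] E) →L[ℂ] ℂ := ℓ.comp (ContinuousLinearMap.apply ℂ E f)
  refine ((ev.analyticAt _).fun_comp hinv).congr ?_
  filter_upwards [hunit, htr] with w hw hew
  exact (hew.coeff_eq (mem_of_resolvent hT hw f)).symm

/-- If `A - z` is bounded below by `d`, transversals exist at all points at distance less than `d`
from `z`. -/
theorem exists_of_bounded_below [CompleteSpace E] (hΓ : IsClosed (Γ : Set (E × E)))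
    (hinj : ∀ h : E, (h, z • h) ∈ Γ → h = 0) (he : IsTransversal Γ e z) {d : ℝ}
    (hd : ∀ g h : E, (h, g + z • h) ∈ Γ → d * ‖h‖ ≤ ‖g‖) {w : ℂ} (hw : ‖w - z‖ < d) :
    ∃ k, IsTransversal Γ k w := by
  obtain ⟨ℓ, T, hT⟩ := he.exists_continuous_decomp hΓ hinj
  have hℓe : ℓ e = 1 := by
    refine he.coeff_unique (hT e) (h' := 0) ?_
    simp [Γ.zero_mem, ← Prod.zero_eq_mk]
  -- The Riesz vector of `ℓ` is orthogonal to `ker ℓ = ran (A - z)`. With it in place of `e`, the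
  -- range component of `f` is an orthogonal projection, so the new operator `S` has norm at most
  -- `d⁻¹` and the Neumann series converges.
  let v : E := (InnerProductSpace.toDual ℂ E).symm ℓ
  have hv : ∀ f, inner ℂ v f = ℓ f := fun f => InnerProductSpace.toDual_symm_apply
  have hv0 : ℓ v ≠ 0 := by
    intro h0
    rw [← hv, inner_self_eq_zero] at h0
    have := hv e
    rw [h0, hℓe] at this
    simp at this
  have hcoeff : ∀ f, transversalCoeff Γ e f z = ℓ f := fun f => he.coeff_eq (hT f)
  have hvt : IsTransversal Γ v z := he.of_coeff_ne_zero (by rwa [hcoeff])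
  obtain ⟨m, S, hS⟩ := hvt.exists_continuous_decomp hΓ hinj
  have hm : ∀ f, ℓ (f - m f • v) = 0 := by
    intro f
    have h1 := he.coeff_mul_coeff hvt f
    rw [hvt.coeff_eq (hS f), hcoeff, hcoeff] at h1
    simp [h1]
  have hd0 : 0 < d := (norm_nonneg _).trans_lt hw
  have hSn : ‖S‖ ≤ d⁻¹ := by
    refine S.opNorm_le_bound (by positivity) fun f => ?_
    have h1 := hd _ _ (hS f)
    have h2 : ‖f - m f • v‖ ≤ ‖f‖ := by
      have horth : inner ℂ (f - m f • v) (m f • v) = 0 := by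
        rw [inner_smul_right, ← inner_conj_symm, hv, hm]
        simp
      have h3 := norm_add_sq_eq_norm_sq_add_norm_sq_of_inner_eq_zero _ _ horth
      rw [sub_add_cancel] at h3
      nlinarith [norm_nonneg (f - m f • v), norm_nonneg f, mul_self_nonneg ‖m f • v‖]
    rw [inv_mul_eq_div, le_div_iff₀ hd0]
    linarith
  refine ⟨v, hvt.of_isUnit hinj hS (isUnit_one_sub_of_norm_lt_one ?_)⟩
  calc ‖(w - z) • S‖ ≤ ‖w - z‖ * d⁻¹ := by
        rw [norm_smul]
        gcongr
    _ < 1 := by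
        rw [← div_eq_mul_inv, div_lt_one hd0]
        exact hw

/-- For symmetric `A` and real `p`, a vector spanning the orthogonal complement of the range of
`A - p` is transversal at all nonreal points. -/
theorem of_im_ne_zero [CompleteSpace E] (hΓ : IsClosed (Γ : Set (E × E))) {p : ℝ}
    (hinj : ∀ h : E, (h, (p : ℂ) • h) ∈ Γ → h = 0)
    (hsymm : ∀ a ∈ Γ, ∀ b ∈ Γ, inner ℂ a.1 b.2 = inner ℂ a.2 b.1)
    (he : IsTransversal Γ e p) (horth : ∀ g h : E, (h, g + (p : ℂ) • h) ∈ Γ → inner ℂ e g = 0)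
    (hz : z.im ≠ 0) : IsTransversal Γ e z := by
  obtain ⟨ℓ, T, hT⟩ := he.exists_continuous_decomp hΓ hinj
  have hℓe : ℓ e = 1 := by
    refine he.coeff_unique (hT e) (h' := 0) ?_
    simp [Γ.zero_mem, ← Prod.zero_eq_mk]
  have hTe : T e = 0 := by
    refine hinj _ ?_
    have := hT e
    rwa [hℓe, one_smul, sub_self, zero_add] at this
  -- By `horth`, `P` is the orthogonal projection onto `ran (A - p)`.
  let P : E →L[ℂ] E := 1 - ℓ.smulRight e
  have hP : ∀ f, P f = f - ℓ f • e := fun f => by simp [P]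
  have hTP : T * P = T := by
    ext f
    simp [hP, hTe]
  have hrange : ∀ f, (T f, P f + (p : ℂ) • T f) ∈ Γ := fun f => by
    rw [hP]
    exact hT f
  have heP : ∀ f, inner ℂ e (P f) = 0 := fun f => horth _ _ (hrange f)
  have hPinner : ∀ f g, inner ℂ (P f) g = inner ℂ (P f) (P g) := by
    intro f g
    rw [hP g, inner_sub_right, inner_smul_right, ← inner_conj_symm _ e, heP]
    simp
  have hPinner' : ∀ f g, inner ℂ f (P g) = inner ℂ (P f) (P g) := by
    intro f g
    rw [hP f, inner_sub_left, inner_smul_left, heP]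
    simp
  -- Symmetry of `A` gives `⟪T f, P g⟫ = ⟪P f, T g⟫`, the terms with the real number `p` cancelling.
  have hsa : IsSelfAdjoint (P * T) := by
    rw [ContinuousLinearMap.isSelfAdjoint_iff_isSymmetric]
    intro f g
    have h1 := hsymm _ (hrange f) _ (hrange g)
    simp only [inner_add_right, inner_add_left, inner_smul_left, inner_smul_right,
      Complex.conj_ofReal, add_left_inj] at h1
    change inner ℂ (P (T f)) g = inner ℂ f (P (T g))
    rw [hPinner, ← hPinner', h1, hPinner' f, ← hPinner]
  have hzp : z - p ≠ 0 := by
    intro h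
    apply hz
    rw [sub_eq_zero.mp h]
    simp
  -- `T = T P` and `P T` have the same nonzero spectrum, and that of `P T` is real.
  have hnot : (z - p)⁻¹ ∉ spectrum ℂ T := by
    intro h
    have h1 : ((Units.mk0 (z - p) hzp)⁻¹ : ℂˣ) ∈ (Units.val ⁻¹' spectrum ℂ (T * P)) := by
      rw [hTP]
      simpa using h
    have h2 := spectrum.unit_mem_mul_comm.mp h1
    have h3 := hsa.mem_spectrum_eq_re h2
    have h4 : ((z - p)⁻¹ : ℂ).im = 0 := by
      have := congrArg Complex.im h3
      simpa using this
    rw [Complex.inv_im] at h4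
    simp [hz] at h4
    exact hzp h4
  refine he.of_isUnit hinj hT ?_
  rw [spectrum.notMem_iff] at hnot
  have h5 : 1 - (z - p) • T = (z - p) • (algebraMap ℂ (E →L[ℂ] E) (z - p)⁻¹ - T) := by
    rw [smul_sub, Algebra.algebraMap_eq_smul_one, smul_smul, mul_inv_cancel₀ hzp, one_smul]
  rw [h5]
  exact (hnot.smul (Units.mk0 (z - p) hzp) :)

end IsTransversal

end Transversal

/-! ### Multiplication by the coordinate in `H`. -/

section MultiplicationGraph

variable {μ : Measure ℝ} {U : Set ℝ} {H : Submodule ℂ (U → ℂ)}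

theorem measureOn_singleton [NullSingletonClass μ] (hU : MeasurableSet U) (x : U) :
    measureOn μ U {x} = 0 := by
  rw [measureOn, Measure.comap_apply _ Subtype.val_injective
    (fun s hs => hU.subtype_image hs) _ (MeasurableSet.singleton x), Set.image_singleton]
  exact measure_singleton _

namespace IsReproducingKernelSubspace

/-- The elements of `L²` represented by functions in `H`. -/
def lpSubmodule (_ : IsReproducingKernelSubspace μ U H) :
    Submodule ℂ (Lp ℂ 2 (measureOn μ U)) where
  carrier := {F | ∃ f ∈ H, (F : U → ℂ) =ᵐ[measureOn μ U] f}
  add_mem' := by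
    rintro F G ⟨f, hf, hFf⟩ ⟨g, hg, hGg⟩
    exact ⟨f + g, H.add_mem hf hg, (Lp.coeFn_add F G).trans (hFf.add hGg)⟩
  zero_mem' := ⟨0, H.zero_mem, Lp.coeFn_zero ℂ 2 _⟩
  smul_mem' := by
    rintro c F ⟨f, hf, hFf⟩
    exact ⟨c • f, H.smul_mem c hf, (Lp.coeFn_smul c F).trans (hFf.const_smul c)⟩

variable (hH : IsReproducingKernelSubspace μ U H)

theorem completeSpace_lpSubmodule : CompleteSpace hH.lpSubmodule :=
  (show IsClosed (hH.lpSubmodule : Set (Lp ℂ 2 (measureOn μ U))) from hH.closed).completeSpace_coe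

theorem eq_of_ae_eq (hH : IsReproducingKernelSubspace μ U H) {f g : U → ℂ} (hf : f ∈ H) (hg : g ∈ H) (hfg : f =ᵐ[measureOn μ U] g) :
    f = g := by
  funext w
  obtain ⟨C, hC⟩ := hH.eval_bounded w
  have h := hC (f - g) (H.sub_mem hf hg)
  have h0 : eLpNorm (f - g) 2 (measureOn μ U) = 0 := by
    rw [eLpNorm_congr_ae (g := 0) (by filter_upwards [hfg] with x hx; simp [hx])]
    exact eLpNorm_zero
  rw [h0] at h
  exact sub_eq_zero.mp (by simpa using h)

/-- The function in `H` representing an element of `lpSubmodule`. -/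
noncomputable def repr : hH.lpSubmodule →ₗ[ℂ] (U → ℂ) where
  toFun F := F.2.choose
  map_add' F G := by
    refine hH.eq_of_ae_eq (F + G).2.choose_spec.1
      (H.add_mem F.2.choose_spec.1 G.2.choose_spec.1) ?_
    exact (F + G).2.choose_spec.2.symm.trans
      ((Lp.coeFn_add _ _).trans (F.2.choose_spec.2.add G.2.choose_spec.2))
  map_smul' c F := by
    refine hH.eq_of_ae_eq (c • F).2.choose_spec.1 (H.smul_mem c F.2.choose_spec.1) ?_
    exact (c • F).2.choose_spec.2.symm.trans
      ((Lp.coeFn_smul _ _).trans (F.2.choose_spec.2.const_smul c))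

theorem repr_mem (F : hH.lpSubmodule) : hH.repr F ∈ H := F.2.choose_spec.1

theorem coeFn_ae_eq_repr (F : hH.lpSubmodule) :
    ((F : Lp ℂ 2 (measureOn μ U)) : U → ℂ) =ᵐ[measureOn μ U] hH.repr F := F.2.choose_spec.2

theorem exists_repr_eq {f : U → ℂ} (hf : f ∈ H) : ∃ F : hH.lpSubmodule, hH.repr F = f := by
  have h := (hH.memLp f hf).coeFn_toLp
  refine ⟨⟨(hH.memLp f hf).toLp f, f, hf, h⟩, hH.eq_of_ae_eq (hH.repr_mem _) hf ?_⟩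
  exact (hH.coeFn_ae_eq_repr _).symm.trans h

theorem eq_zero_of_repr_ae_eq_zero {F : hH.lpSubmodule} (h : hH.repr F =ᵐ[measureOn μ U] 0) :
    F = 0 :=
  Subtype.ext (Lp.eq_zero_iff_ae_eq_zero.mpr ((hH.coeFn_ae_eq_repr F).trans h))

theorem continuous_repr_apply (x : U) : Continuous fun F => hH.repr F x := by
  obtain ⟨C, hC⟩ := hH.eval_bounded x
  let L : hH.lpSubmodule →ₗ[ℂ] ℂ := (LinearMap.proj x).comp hH.repr
  refine (L.mkContinuous C fun F => ?_).continuous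
  have h := hC _ (hH.repr_mem F)
  rwa [← eLpNorm_congr_ae (hH.coeFn_ae_eq_repr F)] at h

theorem inner_eq_integral_repr (F G : hH.lpSubmodule) :
    inner ℂ F G = ∫ x, hH.repr G x * (starRingEnd ℂ) (hH.repr F x) ∂(measureOn μ U) := by
  rw [Submodule.coe_inner, L2.inner_def]
  refine integral_congr_ae ?_
  filter_upwards [hH.coeFn_ae_eq_repr F, hH.coeFn_ae_eq_repr G] with x hF hG
  rw [hF, hG, RCLike.inner_apply]

/-- The graph of multiplication by the coordinate on `lpSubmodule`. -/
def mulGraph : Submodule ℂ (hH.lpSubmodule × hH.lpSubmodule) where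
  carrier := {q | ∀ x : U, hH.repr q.2 x = ((x : ℝ) : ℂ) * hH.repr q.1 x}
  add_mem' := by
    intro a b ha hb x
    simp only [Prod.fst_add, Prod.snd_add, map_add, Pi.add_apply, ha x, hb x]
    ring
  zero_mem' := by
    intro x
    simp
  smul_mem' := by
    intro c a ha x
    simp only [Prod.smul_fst, Prod.smul_snd, map_smul, Pi.smul_apply, ha x, smul_eq_mul]
    ring

theorem mem_mulGraph {F G : hH.lpSubmodule} :
    (F, G) ∈ hH.mulGraph ↔ ∀ x : U, hH.repr G x = ((x : ℝ) : ℂ) * hH.repr F x := Iff.rfl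

theorem mem_mulGraph_add_smul {F G : hH.lpSubmodule} {z : ℂ} :
    (F, G + z • F) ∈ hH.mulGraph ↔
      ∀ x : U, hH.repr G x = (((x : ℝ) : ℂ) - z) * hH.repr F x := by
  rw [mem_mulGraph]
  refine forall_congr' fun x => ?_
  simp only [map_add, map_smul, Pi.add_apply, Pi.smul_apply, smul_eq_mul, sub_mul]
  exact eq_sub_iff_add_eq.symm

theorem isClosed_mulGraph :
    IsClosed (hH.mulGraph : Set (hH.lpSubmodule × hH.lpSubmodule)) := by
  have h : (hH.mulGraph : Set (hH.lpSubmodule × hH.lpSubmodule)) =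
      ⋂ x : U, {q | hH.repr q.2 x = ((x : ℝ) : ℂ) * hH.repr q.1 x} := by
    ext q
    simp only [Set.mem_iInter]
    rfl
  rw [h]
  refine isClosed_iInter fun x => isClosed_eq ?_ ?_
  · exact (hH.continuous_repr_apply x).comp continuous_snd
  · exact continuous_const.mul ((hH.continuous_repr_apply x).comp continuous_fst)

theorem inner_mulGraph (a : hH.lpSubmodule × hH.lpSubmodule) (ha : a ∈ hH.mulGraph)
    (b : hH.lpSubmodule × hH.lpSubmodule) (hb : b ∈ hH.mulGraph) :
    inner ℂ a.1 b.2 = inner ℂ a.2 b.1 := by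
  rw [inner_eq_integral_repr, inner_eq_integral_repr]
  refine integral_congr_ae (Eventually.of_forall fun x => ?_)
  simp only [ha x, hb x, map_mul, Complex.conj_ofReal]
  ring

/-- An eigenfunction vanishes off at most one point, and points are null sets. -/
theorem eq_zero_of_mem_mulGraph [NullSingletonClass μ] (hU : MeasurableSet U) (z : ℂ)
    (F : hH.lpSubmodule) (hF : (F, z • F) ∈ hH.mulGraph) : F = 0 := by
  rw [← zero_add (z • F), mem_mulGraph_add_smul] at hF
  simp only [map_zero, Pi.zero_apply, zero_eq_mul, sub_eq_zero] at hF
  refine hH.eq_zero_of_repr_ae_eq_zero ?_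
  have hsub : {x : U | ((x : ℝ) : ℂ) = z}.Subsingleton := fun x hx y hy =>
    Subtype.ext (Complex.ofReal_injective (hx.trans hy.symm))
  have hnull : measureOn μ U {x : U | ((x : ℝ) : ℂ) = z} = 0 := by
    rcases hsub.eq_empty_or_singleton with h | ⟨x, h⟩
    · rw [h, measure_empty]
    · rw [h, measureOn_singleton hU]
  filter_upwards [measure_eq_zero_iff_ae_notMem.mp hnull] with x hx
  exact (hF x).resolve_left hx

theorem norm_mulGraph_ge {d : ℝ} {z : ℂ} (hd : 0 < d)
    (hdz : ∀ x : U, d ≤ ‖((x : ℝ) : ℂ) - z‖) (G F : hH.lpSubmodule)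
    (hF : (F, G + z • F) ∈ hH.mulGraph) : d * ‖F‖ ≤ ‖G‖ := by
  rw [mem_mulGraph_add_smul] at hF
  have h : ‖(F : Lp ℂ 2 (measureOn μ U))‖ ≤ d⁻¹ * ‖(G : Lp ℂ 2 (measureOn μ U))‖ := by
    refine Lp.norm_le_mul_norm_of_ae_le_mul ?_
    filter_upwards [hH.coeFn_ae_eq_repr F, hH.coeFn_ae_eq_repr G] with x hFx hGx
    rw [hFx, hGx, hF x, norm_mul, inv_mul_eq_div, le_div_iff₀ hd, mul_comm]
    exact mul_le_mul_of_nonneg_right (hdz x) (norm_nonneg _)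
  rwa [inv_mul_eq_div, le_div_iff₀ hd, mul_comm] at h

/-- Transversality at a point of `U` follows from the weak division property. -/
theorem isTransversal_of_repr_ne_zero (hdiv : WeakDivision U H) {e : hH.lpSubmodule} {x : U}
    (hx : hH.repr e x ≠ 0) : IsTransversal hH.mulGraph e ((x : ℝ) : ℂ) := by
  refine ⟨fun F => ?_, fun h hh => hx ?_⟩
  · obtain ⟨g, hg, hgx⟩ := hdiv x (hH.repr (F - (hH.repr F x / hH.repr e x) • e))
      (hH.repr_mem _) (by simp [hx])
    obtain ⟨G, rfl⟩ := hH.exists_repr_eq hg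
    exact ⟨_, G, hH.mem_mulGraph_add_smul.mpr hgx⟩
  · simpa using hH.mem_mulGraph_add_smul.mp hh x

theorem repr_eq_coeff_mul {e : hH.lpSubmodule} {x : U}
    (he : IsTransversal hH.mulGraph e ((x : ℝ) : ℂ)) (F : hH.lpSubmodule) :
    hH.repr F x = transversalCoeff hH.mulGraph e F ((x : ℝ) : ℂ) * hH.repr e x := by
  obtain ⟨h, hh⟩ := he.coeff_spec F
  have := hH.mem_mulGraph_add_smul.mp hh x
  simpa [sub_eq_zero] using this

/-- Every function in `H` is a multiple of `e` at `x`, so a zero of `e` there would be common to all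
of `H`. -/
theorem repr_ne_zero (hsep : SeparatesZeros U H) {e : hH.lpSubmodule} {x : U}
    (he : IsTransversal hH.mulGraph e ((x : ℝ) : ℂ)) : hH.repr e x ≠ 0 := by
  intro h0
  obtain ⟨f, hf, hfx⟩ := hsep x
  obtain ⟨F, rfl⟩ := hH.exists_repr_eq hf
  apply hfx
  rw [hH.repr_eq_coeff_mul he F, h0, mul_zero]

theorem inner_repr_kernel {k : hH.lpSubmodule} {p : U} (hk : IsKernelAt μ U H p (hH.repr k))
    (F : hH.lpSubmodule) : inner ℂ k F = hH.repr F p := by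
  rw [inner_eq_integral_repr, hk.2 _ (hH.repr_mem F)]

theorem repr_kernel_self_ne_zero (hsep : SeparatesZeros U H) {k : hH.lpSubmodule} {p : U}
    (hk : IsKernelAt μ U H p (hH.repr k)) : hH.repr k p ≠ 0 := by
  intro h0
  rw [← hH.inner_repr_kernel hk] at h0
  have hk0 : k = 0 := inner_self_eq_zero (𝕜 := ℂ).mp h0
  obtain ⟨f, hf, hfx⟩ := hsep p
  obtain ⟨F, rfl⟩ := hH.exists_repr_eq hf
  apply hfx
  rw [← hH.inner_repr_kernel hk, hk0, inner_zero_left]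

/-- Functions in `ran (A - p)` vanish at `p`, which says that they are orthogonal to `K_p`. -/
theorem isTransversal_kernel_of_im_ne_zero [NullSingletonClass μ] (hU : MeasurableSet U)
    (hsep : SeparatesZeros U H) (hdiv : WeakDivision U H) {k : hH.lpSubmodule} {p : U}
    (hk : IsKernelAt μ U H p (hH.repr k)) {z : ℂ} (hz : z.im ≠ 0) :
    IsTransversal hH.mulGraph k z := by
  have := hH.completeSpace_lpSubmodule
  refine IsTransversal.of_im_ne_zero hH.isClosed_mulGraph (hH.eq_zero_of_mem_mulGraph hU _)
    hH.inner_mulGraph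
    (hH.isTransversal_of_repr_ne_zero hdiv (hH.repr_kernel_self_ne_zero hsep hk)) ?_ hz
  intro G F hF
  rw [hH.inner_repr_kernel hk]
  simpa using hH.mem_mulGraph_add_smul.mp hF p

/-- Transversals exist at every real point off the boundary of `U`. -/
theorem exists_isTransversal [NullSingletonClass μ] (hU : MeasurableSet U)
    (hsep : SeparatesZeros U H) (hdiv : WeakDivision U H) {k : hH.lpSubmodule} {p : U}
    (hk : IsKernelAt μ U H p (hH.repr k)) {a : ℝ} (ha : a ∉ frontier U) :
    ∃ e, IsTransversal hH.mulGraph e (a : ℂ) := by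
  have := hH.completeSpace_lpSubmodule
  by_cases haU : a ∈ U
  · obtain ⟨f, hf, hfa⟩ := hsep ⟨a, haU⟩
    obtain ⟨F, rfl⟩ := hH.exists_repr_eq hf
    exact ⟨F, hH.isTransversal_of_repr_ne_zero hdiv hfa⟩
  · have hcl : a ∉ closure U := fun h => ha ⟨h, fun hi => haU (interior_subset hi)⟩
    obtain ⟨ε, hε, hball⟩ := Metric.isOpen_iff.mp isClosed_closure.isOpen_compl a hcl
    -- A nonreal point, where `K_p` is transversal, at distance `ε / 2` from `a` and at distance at
    -- least `ε` from `U`.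
    let z : ℂ := a + (ε / 2 : ℝ) * Complex.I
    have hz : z.im = ε / 2 := by simp [z]
    have hre : z.re = a := by simp [z]
    have hzt := hH.isTransversal_kernel_of_im_ne_zero hU hsep hdiv hk (z := z)
      (by rw [hz]; positivity)
    refine hzt.exists_of_bounded_below hH.isClosed_mulGraph
      (hH.eq_zero_of_mem_mulGraph hU _) (d := ε) (hH.norm_mulGraph_ge hε fun x => ?_) ?_
    · have h1 : ε ≤ |(x : ℝ) - a| := by
        by_contra! h
        exact hball (Metric.mem_ball.mpr h) (subset_closure x.2)
      refine h1.trans ?_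
      have := Complex.abs_re_le_norm (((x : ℝ) : ℂ) - z)
      simpa [hre] using this
    · have h2 : (a : ℂ) - z = -((ε / 2 : ℝ) * Complex.I) := by simp [z]
      rw [h2, norm_neg, norm_mul, Complex.norm_I, mul_one, Complex.norm_real, Real.norm_eq_abs,
        abs_of_pos (by positivity)]
      linarith

end IsReproducingKernelSubspace

end MultiplicationGraph

/-! ### The kernel near real points off the boundary. -/

section Boundary

variable {μ : Measure ℝ} {U : Set ℝ} {H : Submodule ℂ (U → ℂ)}

namespace IsReproducingKernelSubspace

variable (hH : IsReproducingKernelSubspace μ U H)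

/-- Near a real point off the boundary of `U`, the kernel is transversal at all points except
possibly that one, and its coefficients are meromorphic. -/
theorem eventually_isTransversal_kernel [NullSingletonClass μ] (hU : MeasurableSet U)
    (hsep : SeparatesZeros U H) (hdiv : WeakDivision U H) {k : hH.lpSubmodule} {p : U}
    (hk : IsKernelAt μ U H p (hH.repr k)) {a : ℝ} (ha : a ∉ frontier U) :
    (∀ᶠ z in 𝓝[≠] (a : ℂ), IsTransversal hH.mulGraph k z) ∧
      ∀ F, MeromorphicAt (transversalCoeff hH.mulGraph k F) a := by
  have := hH.completeSpace_lpSubmodule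
  obtain ⟨e, he⟩ := hH.exists_isTransversal hU hsep hdiv hk ha
  obtain ⟨hev, han⟩ := he.eventually_and_analyticAt hH.isClosed_mulGraph
    (hH.eq_zero_of_mem_mulGraph hU _)
  have hne : ∀ᶠ z in 𝓝[≠] (a : ℂ), transversalCoeff hH.mulGraph e k z ≠ 0 := by
    -- The coefficient cannot vanish identically near `a`: at nearby nonreal points both `e` and `k`
    -- are transversal.
    refine (han k).eventually_eq_zero_or_eventually_ne_zero.resolve_left fun h0 => ?_
    obtain ⟨ε, hε, hball⟩ := Metric.eventually_nhds_iff.mp (h0.and hev)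
    let z : ℂ := a + (ε / 2 : ℝ) * Complex.I
    have hz : z.im ≠ 0 := by
      simp only [z, Complex.add_im, Complex.ofReal_im, Complex.im_ofReal_mul,
        Complex.I_im]
      positivity
    have hza : dist z a < ε := by
      simp only [z, dist_eq_norm, add_sub_cancel_left, norm_mul, Complex.norm_I, mul_one,
        Complex.norm_real, Real.norm_eq_abs]
      rw [abs_of_pos (by positivity)]
      linarith
    exact (hball hza).2.coeff_ne_zero
      (hH.isTransversal_kernel_of_im_ne_zero hU hsep hdiv hk hz) (hball hza).1
  have htr : ∀ᶠ z in 𝓝[≠] (a : ℂ), IsTransversal hH.mulGraph k z := by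
    filter_upwards [hne, hev.filter_mono nhdsWithin_le_nhds] with z hz hez
    exact hez.of_coeff_ne_zero hz
  refine ⟨htr, fun F => ?_⟩
  refine ((han F).meromorphicAt.div (han k).meromorphicAt).congr ?_
  filter_upwards [hne, htr, hev.filter_mono nhdsWithin_le_nhds] with z hz hkz hez
  rw [Pi.div_apply, hez.coeff_mul_coeff hkz F, mul_div_cancel_right₀ _ hz]

end IsReproducingKernelSubspace

end Boundary

/-! ### The extension of `f / K_p`. -/

theorem theorem3p5 (μ : Measure ℝ) [SigmaFinite μ] [NullSingletonClass μ] (U : Set ℝ)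
    (hU : MeasurableSet U) (hμU : μ Uᶜ = 0) (H : Submodule ℂ (U → ℂ))
    (hH : IsReproducingKernelSubspace μ U H) (hsep : SeparatesZeros U H)
    (hdiv : WeakDivision U H) (p : U) :
    -- (1) the zeros of `K_p` accumulate, at finite distance, only in `∂U`
    derivedSet (((↑) : U → ℝ) '' {x : U | reproducingKernel μ U H p x = 0}) ⊆ frontier U ∧
    ∃ V : Set ℂ, IsOpen V ∧ ((p : ℝ) : ℂ) ∈ V ∧
      (∀ x : U, ((x : ℝ) : ℂ) ∈ V → reproducingKernel μ U H p x ≠ 0) ∧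
    ∃ N : Set ℝ, N ⊆ (frontier U)ᶜ ∧ derivedSet N ⊆ frontier U ∧
    ∀ f ∈ H, ∃ F : ℂ → ℂ,
      -- (2) `F` is an analytic extension of `f / K_p` to `V`
      (AnalyticOnNhd ℂ F V ∧
        ∀ x : U, ((x : ℝ) : ℂ) ∈ V → F ((x : ℝ) : ℂ) = f x / reproducingKernel μ U H p x) ∧
      -- (3) `F` is a meromorphic extension of `f / K_p` to `ℂ \ ∂U` with all poles in `N`
      (MeromorphicOn F (Complex.ofReal '' frontier U)ᶜ ∧
        AnalyticOnNhd ℂ F ((Complex.ofReal '' frontier U)ᶜ \ Complex.ofReal '' N) ∧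
        ∀ x : U, (x : ℝ) ∉ frontier U → reproducingKernel μ U H p x ≠ 0 →
          F ((x : ℝ) : ℂ) = f x / reproducingKernel μ U H p x) := by
  obtain ⟨k, hkK⟩ := hH.exists_repr_eq (hH.isKernelAt_reproducingKernel p).1
  have hk : IsKernelAt μ U H p (hH.repr k) := hkK ▸ hH.isKernelAt_reproducingKernel p
  simp only [← hkK]
  have := hH.completeSpace_lpSubmodule
  -- The full transversality set serves as the neighbourhood of `p`; it contains all nonreal points.
  set V : Set ℂ := {z | IsTransversal hH.mulGraph k z} with hV
  have hloc : ∀ z ∈ V, (∀ᶠ w in 𝓝 z, w ∈ V) ∧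
      ∀ F, AnalyticAt ℂ (transversalCoeff hH.mulGraph k F) z := fun z hz =>
    hz.eventually_and_analyticAt hH.isClosed_mulGraph (hH.eq_zero_of_mem_mulGraph hU _)
  have him : ∀ z : ℂ, z.im ≠ 0 → z ∈ V := fun z hz =>
    hH.isTransversal_kernel_of_im_ne_zero hU hsep hdiv hk hz
  have hvalue : ∀ F (x : U), ((x : ℝ) : ℂ) ∈ V →
      transversalCoeff hH.mulGraph k F ((x : ℝ) : ℂ) = hH.repr F x / hH.repr k x := by
    intro F x hx
    rw [eq_div_iff (hH.repr_ne_zero hsep hx), hH.repr_eq_coeff_mul hx F]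
  set N : Set ℝ := {a | a ∉ frontier U ∧ (a : ℂ) ∉ V} with hN
  have hNacc : derivedSet N ⊆ frontier U := by
    intro a ha
    by_contra hfr
    rw [mem_derivedSet, accPt_iff_frequently] at ha
    have h1 := (hH.eventually_isTransversal_kernel hU hsep hdiv hk hfr).1
    rw [eventually_nhdsWithin_iff] at h1
    have h2 := Complex.continuous_ofReal.continuousAt.eventually h1
    obtain ⟨b, ⟨hba, hbN⟩, hb⟩ := (ha.and_eventually h2).exists
    exact hbN.2 (hb (by simpa using hba))
  refine ⟨?_, V, isOpen_iff_mem_nhds.mpr fun z hz => (hloc z hz).1,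
    hH.isTransversal_of_repr_ne_zero hdiv (hH.repr_kernel_self_ne_zero hsep hk),
    fun x hx => hH.repr_ne_zero hsep hx, N, fun a ha => ha.1, hNacc, fun f hf => ?_⟩
  · have hsub : ((↑) : U → ℝ) '' {x : U | hH.repr k x = 0} ⊆ frontier U ∪ N := by
      rintro _ ⟨x, hx, rfl⟩
      by_cases hfr : (x : ℝ) ∈ frontier U
      · exact Or.inl hfr
      · exact Or.inr ⟨hfr, fun hV => hH.repr_ne_zero hsep hV hx⟩
    refine (derivedSet_mono _ _ hsub).trans ?_
    rw [derivedSet_union]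
    exact Set.union_subset (isClosed_iff_derivedSet_subset _ |>.mp isClosed_frontier) hNacc
  · obtain ⟨F, rfl⟩ := hH.exists_repr_eq hf
    refine ⟨transversalCoeff hH.mulGraph k F, ⟨fun z hz => (hloc z hz).2 F, hvalue F⟩,
      fun z hz => ?_, fun z hz => ?_, fun x _ hx =>
        hvalue F x (hH.isTransversal_of_repr_ne_zero hdiv hx)⟩
    · by_cases h : z.im = 0
      · obtain ⟨a, rfl⟩ : ∃ a : ℝ, (a : ℂ) = z := ⟨z.re, Complex.ext rfl (by simp [h])⟩
        exact (hH.eventually_isTransversal_kernel hU hsep hdiv hk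
          fun ha => hz ⟨a, ha, rfl⟩).2 F
      · exact ((hloc z (him z h)).2 F).meromorphicAt
    · refine (hloc z ?_).2 F
      by_cases h : z.im = 0
      · obtain ⟨a, rfl⟩ : ∃ a : ℝ, (a : ℂ) = z := ⟨z.re, Complex.ext rfl (by simp [h])⟩
        by_contra hzV
        exact hz.2 ⟨a, ⟨fun ha => hz.1 ⟨a, ha, rfl⟩, hzV⟩, rfl⟩
      · exact him z h
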